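/- **Proposition (Fast rate implies stability).** Let $\mathcal X$ be a separable metric space with its Borel $\sigma$-algebra, $\mathcal Y$ a measurable space, and let $(X_1,Y_1),(X_2,Y_2),\dots$ be i.i.d. with law $P$, where $X\sim P_X$ and $Y\mid X=x\sim P_{Y|x}$. Write $\mathcal D_n=((X_i,Y_i))_{i\le n}$. Let $Z\subset\mathbb R^{d}$ and let $\ell:\mathbb R^d\times\mathcal Y\to\mathbb R$ be a measurable cost such that: 1. for every $x$, $v(z;x)=\mathbb E_{P_{Y|x}}[\ell(z;Y)]$ is twice differentiable in $z\in Z$; 2. for every $y$, $\ell(\cdot;y)$ is twice differentiable on $Z$, and $|\ell(z;y)|$ and $\|\nabla_z\ell(z;y)\|$ are bounded uniformly in $z\in Z$ and almost surely in $y$; 3. $Z$ is bounded and open, and for every $x$ a minimiser $z_o^*(x)$ of $v(\cdot;x)$ over $Z$ exists, with $\nabla_z v(z_o^*(x);x)=0$ and $\nabla_{zz}v(z_o^*(x);x)$ positive definite. Let $\hat z$ be a nonparametric learner: for every $n$, $\hat z(x)=\hat z_n(\mathcal D_n;x)\in Z$ depends measurably on $(\mathcal D_n,x)$, and almost surely,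 for all $x$, it minimises $\sum_{i\le n}w_{n,i}(x)\ell(z;Y_i)$ over $z\in Z$, where the real weights $w_{n,i}(x)$ are measurable functions of $\mathcal D_n$ and $x$. Let $\hat z^{(-i)}$ be the learner trained on the $n-1$ data points other than the $i$-th, let $X\sim P_X$ be independent of the data, and put $$\alpha_n=\max_{i\le n}\big(\mathbb E\|\hat z(X)-\hat z^{(-i)}(X)\|^2\big)^{1/2},\qquad \beta_n=\max_{i\le n}\mathbb E\|\hat z(X_i)-\hat z^{(-i)}(X_i)\| .$$ Suppose that $\hat z$ has variability rate $\gamma_v$, i.e. $\mathbb E\|\hat z(x)-\mathbb E\hat z(x)\|=\Theta(n^{-\gamma_v})$ for $P_X$-almost every $x$, and satisfies the following expansion conditions. A remainder $R_n(\mathcal D_n,x)$ is said to be $O(a_n)$ *in mean* if (for large $n$) it is integrable and $\mathbb E\|R_n(\mathcal D_n,X)\|=O(a_n)$, and likewise at the data points, $\max_{i\le n}\mathbb E\|R_n(\mathcal D_n,X_i)\|=O(a_n)$. * There is a deterministic $z_n(x)$ such that for all large $n$ and $P_X$-almost every $x$: $z_n(x)\in Z$ is a root of $\mathbb E[\sum_i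 w_{n,i}(x)\nabla_z\ell(z;Y_i)]=0$ (the sum being integrable at this root); for each $z\in Z$, $\sum_i w_{n,i}(x)\ell(z;Y_i)$ is integrable; $R_{n,x}(z)=\mathbb E[\frac1n\sum_i w_{n,i}(x)\ell(z;Y_i)]$ is differentiable on $Z$, its gradient is differentiable at $z_n(x)$, and the Hessian $H_{n,x}=\nabla^2R_{n,x}(z_n(x))$ is invertible. * In mean, $\hat z(x)-z_n(x)=-H_{n,x}^{-1}\frac1n\sum_{i}w_{n,i}(x)\nabla_z\ell(z_n(x);Y_i)+O(n^{-2\gamma_v})$. * One of the following holds. (a) *Nearest neighbours:* $w_{n,i}(x)$ is the indicator that $X_i$ is one of the $k_n$ nearest neighbours of $x$ in $\mathcal D_n$ (ties broken by the smaller index), where $k_n\le n$ is deterministic and $k_n=\Theta(n^{2\gamma_v})$; and, with $H_{k_n,x}=\frac{n}{k_n}H_{n,x}$ (the Hessian of the expected cost averaged over the $k_n$ neighbours), there are functions $g_n$ with $\mathbb E[g_n(X)^2]<\infty$ for every $n$, $\mathbb E[g_n(X)^2]=O(1)$, and, for all large $n$, $\|H_{k_n,x}^{-1}\|\le g_n(x)$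 for $P_X$-almost every $x$. (b) *Influence functions:* there are jointly measurable $\phi_{n,x}(x',y)\in\mathbb R^d$ such that, in mean, $\hat z(x)-z_n(x)=\frac1n\sum_i\phi_{n,x}(X_i,Y_i)+O(n^{-2\gamma_v})$; for all large $n$ and $P_X$-almost every $x$, $\phi_{n,x}(X,Y)$ is square integrable with $\mathbb E[\phi_{n,x}(X,Y)]=0$; for $P_X$-almost every $x$, $(\mathbb E\|\phi_{n,x}(X,Y)\|^2)^{1/2}=\Theta(n^{1/2-\gamma_v})$; and for all large $n$, $\phi_{n,X}(X,Y)$ is square integrable with $\mathbb E[\phi_{n,X}(X,Y)]=0$, and $(\mathbb E\|\phi_{n,X}(X,Y)\|^2)^{1/2}=O(n^{1-2\gamma_v})$. If $\alpha_n=o(n^{-1/2})$ and $\gamma_v>1/4$, then $\beta_n=o(n^{-1/2})$. -/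

import Mathlib

open MeasureTheory ProbabilityTheory Filter Asymptotics
open scoped Topology

namespace FastRate

noncomputable section

/-- The joint law of `(X, Y)`: `X` has law `pX` and `Y` given `X = x` has law `κ x`. -/
def jointLaw {𝒳 𝒴 : Type*} [MeasurableSpace 𝒳] [MeasurableSpace 𝒴]
    (pX : Measure 𝒳) (κ : Kernel 𝒳 𝒴) : Measure (𝒳 × 𝒴) :=
  pX ⊗ₘ κ

/-- The law of an i.i.d. data set `D = ((X_1, Y_1), …, (X_n, Y_n))`. -/
def dataLaw {𝒳 𝒴 : Type*} [MeasurableSpace 𝒳] [MeasurableSpace 𝒴]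
    (pX : Measure 𝒳) (κ : Kernel 𝒳 𝒴) (n : ℕ) : Measure (Fin n → 𝒳 × 𝒴) :=
  Measure.pi fun _ => jointLaw pX κ

/-! ### The cost function -/

/-- `f` is twice differentiable on the (open) set `Z`. -/
def TwiceDiffOn {d : ℕ} (f : EuclideanSpace ℝ (Fin d) → ℝ)
    (Z : Set (EuclideanSpace ℝ (Fin d))) : Prop :=
  DifferentiableOn ℝ f Z ∧ DifferentiableOn ℝ (gradient f) Z

/-- The Hessian of `f` at `z`, as a linear operator. -/
def hess {d : ℕ} (f : EuclideanSpace ℝ (Fin d) → ℝ) (z : EuclideanSpace ℝ (Fin d)) :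
    EuclideanSpace ℝ (Fin d) →L[ℝ] EuclideanSpace ℝ (Fin d) :=
  fderiv ℝ (gradient f) z

/-- The expected cost `v(z; x) = E[ℓ(z; Y) | X = x]`. -/
def expectedCost {𝒳 𝒴 : Type*} [MeasurableSpace 𝒳] [MeasurableSpace 𝒴] {d : ℕ}
    (κ : Kernel 𝒳 𝒴) (ℓ : EuclideanSpace ℝ (Fin d) → 𝒴 → ℝ) (x : 𝒳)
    (z : EuclideanSpace ℝ (Fin d)) : ℝ :=
  ∫ y, ℓ z y ∂(κ x)

/-- Smoothness of the expected cost. -/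
def SmoothExpectedCost {𝒳 𝒴 : Type*} [MeasurableSpace 𝒳] [MeasurableSpace 𝒴] {d : ℕ}
    (κ : Kernel 𝒳 𝒴) (ℓ : EuclideanSpace ℝ (Fin d) → 𝒴 → ℝ)
    (Z : Set (EuclideanSpace ℝ (Fin d))) : Prop :=
  ∀ x, TwiceDiffOn (expectedCost κ ℓ x) Z

/-- Regularity of the cost: twice differentiable in `z`, with cost and gradient bounded
uniformly in `z ∈ Z` and almost surely in `y`. -/
def RegularCost {𝒳 𝒴 : Type*} [MeasurableSpace 𝒳] [MeasurableSpace 𝒴] {d : ℕ}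
    (pX : Measure 𝒳) (κ : Kernel 𝒳 𝒴) (ℓ : EuclideanSpace ℝ (Fin d) → 𝒴 → ℝ)
    (Z : Set (EuclideanSpace ℝ (Fin d))) : Prop :=
  (∀ y, TwiceDiffOn (fun z => ℓ z y) Z) ∧
  ∃ M : ℝ, ∀ᵐ y ∂(jointLaw pX κ).snd, ∀ z ∈ Z,
    |ℓ z y| ≤ M ∧ ‖gradient (fun z => ℓ z y) z‖ ≤ M

/-- Optimality conditions: `Z` is bounded and open, and the best mapping `zo`, which minimises
`v(·; x)` over `Z` for every `x`, has zero gradient and positive definite Hessian there. -/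
def OptimalityConditions {𝒳 𝒴 : Type*} [MeasurableSpace 𝒳] [MeasurableSpace 𝒴] {d : ℕ}
    (κ : Kernel 𝒳 𝒴) (ℓ : EuclideanSpace ℝ (Fin d) → 𝒴 → ℝ)
    (Z : Set (EuclideanSpace ℝ (Fin d))) : Prop :=
  IsOpen Z ∧ Bornology.IsBounded Z ∧
  ∃ zo : 𝒳 → EuclideanSpace ℝ (Fin d), ∀ x,
    zo x ∈ Z ∧ IsMinOn (expectedCost κ ℓ x) Z (zo x) ∧
    gradient (expectedCost κ ℓ x) (zo x) = 0 ∧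
    ∀ u, u ≠ 0 → 0 < inner ℝ (hess (expectedCost κ ℓ x) (zo x) u) u

/-! ### Learners

A learner `zhat` maps a data set `D` of any size `n` to a decision mapping `x ↦ zhat n D x`.
The weights are `w n D i x`. -/

/-- The nonparametric model: `zhat n D x` minimises `∑ i, w_{n,i}(x) ℓ(z; Y_i)` over `Z`. -/
structure IsWeightedLearner {𝒳 𝒴 : Type*} [MeasurableSpace 𝒳] [MeasurableSpace 𝒴] {d : ℕ}
    (pX : Measure 𝒳) (κ : Kernel 𝒳 𝒴) (ℓ : EuclideanSpace ℝ (Fin d) → 𝒴 → ℝ)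
    (Z : Set (EuclideanSpace ℝ (Fin d)))
    (w : (n : ℕ) → (Fin n → 𝒳 × 𝒴) → Fin n → 𝒳 → ℝ)
    (zhat : (n : ℕ) → (Fin n → 𝒳 × 𝒴) → 𝒳 → EuclideanSpace ℝ (Fin d)) : Prop where
  measurable_w : ∀ n i, Measurable fun p : (Fin n → 𝒳 × 𝒴) × 𝒳 => w n p.1 i p.2
  measurable_zhat : ∀ n, Measurable fun p : (Fin n → 𝒳 × 𝒴) × 𝒳 => zhat n p.1 p.2
  mem : ∀ n D x, zhat n D x ∈ Z
  isMinOn : ∀ n, ∀ᵐ D ∂(dataLaw pX κ n), ∀ x,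
    IsMinOn (fun z => ∑ i, w n D i x * ℓ z (D i).2) Z (zhat n D x)

/-- `zhat` has variability convergence rate `γv`: for almost every `x`,
`E ‖zhat(x) - E zhat(x)‖ = Θ(n ^ (-γv))`. -/
def HasVariabilityRate {𝒳 𝒴 : Type*} [MeasurableSpace 𝒳] [MeasurableSpace 𝒴] {d : ℕ}
    (pX : Measure 𝒳) (κ : Kernel 𝒳 𝒴)
    (zhat : (n : ℕ) → (Fin n → 𝒳 × 𝒴) → 𝒳 → EuclideanSpace ℝ (Fin d)) (γv : ℝ) : Prop :=
  ∀ᵐ x ∂pX,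
    (fun n : ℕ => ∫ D, ‖zhat n D x - ∫ D', zhat n D' x ∂(dataLaw pX κ n)‖ ∂(dataLaw pX κ n))
      =Θ[atTop] fun n : ℕ => (n : ℝ) ^ (-γv)

/-- Expected LOO stability `α_n`, the maximum over `i` of
`(E ‖zhat(X) - zhat^{(-i)}(X)‖²)^{1/2}` with `X` independent of the data;
`zhat^{(-i)}` is trained on the `n - 1` points other than the `i`-th. -/
def expectedLOO {𝒳 𝒴 : Type*} [MeasurableSpace 𝒳] [MeasurableSpace 𝒴] {d : ℕ}
    (pX : Measure 𝒳) (κ : Kernel 𝒳 𝒴)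
    (zhat : (n : ℕ) → (Fin n → 𝒳 × 𝒴) → 𝒳 → EuclideanSpace ℝ (Fin d)) : ℕ → ℝ
  | 0 => 0
  | m + 1 => ⨆ i : Fin (m + 1),
      √(∫ p, ‖zhat (m + 1) p.1 p.2 - zhat m (i.removeNth p.1) p.2‖ ^ 2
        ∂((dataLaw pX κ (m + 1)).prod pX))

/-- Pointwise LOO stability `β_n`, the maximum over `i` of `E ‖zhat(X_i) - zhat^{(-i)}(X_i)‖`. -/
def pointwiseLOO {𝒳 𝒴 : Type*} [MeasurableSpace 𝒳] [MeasurableSpace 𝒴] {d : ℕ}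
    (pX : Measure 𝒳) (κ : Kernel 𝒳 𝒴)
    (zhat : (n : ℕ) → (Fin n → 𝒳 × 𝒴) → 𝒳 → EuclideanSpace ℝ (Fin d)) : ℕ → ℝ
  | 0 => 0
  | m + 1 => ⨆ i : Fin (m + 1),
      ∫ D, ‖zhat (m + 1) D (D i).1 - zhat m (i.removeNth D) (D i).1‖ ∂(dataLaw pX κ (m + 1))

/-! ### Expansion conditions -/

/-- A remainder `R n D x` is of order `a n` in mean, both at a new covariate `X` independent of
the data and, uniformly in `i`, at the covariates `X_i` of the data. -/
def MeanBigO {𝒳 𝒴 : Type*} [MeasurableSpace 𝒳] [MeasurableSpace 𝒴] {d : ℕ}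
    (pX : Measure 𝒳) (κ : Kernel 𝒳 𝒴)
    (R : (n : ℕ) → (Fin n → 𝒳 × 𝒴) → 𝒳 → EuclideanSpace ℝ (Fin d)) (a : ℕ → ℝ) : Prop :=
  (∀ᶠ n : ℕ in atTop, Integrable (fun p : (Fin n → 𝒳 × 𝒴) × 𝒳 => R n p.1 p.2)
      ((dataLaw pX κ n).prod pX)) ∧
  ((fun n => ∫ p, ‖R n p.1 p.2‖ ∂((dataLaw pX κ n).prod pX)) =O[atTop] a) ∧
  (∀ᶠ n : ℕ in atTop, ∀ i : Fin n, Integrable (fun D => R n D (D i).1) (dataLaw pX κ n)) ∧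
  ((fun n => ⨆ i : Fin n, ∫ D, ‖R n D (D i).1‖ ∂(dataLaw pX κ n)) =O[atTop] a)

/-- The expected weighted cost `E[(1/n) ∑ i, w_{n,i}(x) ℓ(z; Y_i)]`. -/
def weightedRisk {𝒳 𝒴 : Type*} [MeasurableSpace 𝒳] [MeasurableSpace 𝒴] {d : ℕ}
    (pX : Measure 𝒳) (κ : Kernel 𝒳 𝒴) (ℓ : EuclideanSpace ℝ (Fin d) → 𝒴 → ℝ)
    (w : (n : ℕ) → (Fin n → 𝒳 × 𝒴) → Fin n → 𝒳 → ℝ) (n : ℕ) (x : 𝒳)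
    (z : EuclideanSpace ℝ (Fin d)) : ℝ :=
  ∫ D, (n : ℝ)⁻¹ * ∑ i, w n D i x * ℓ z (D i).2 ∂(dataLaw pX κ n)

/-- `H_{n,x}`, the Hessian in `z` of the expected weighted cost, at `z = z_n(x)`. -/
def weightedHess {𝒳 𝒴 : Type*} [MeasurableSpace 𝒳] [MeasurableSpace 𝒴] {d : ℕ}
    (pX : Measure 𝒳) (κ : Kernel 𝒳 𝒴) (ℓ : EuclideanSpace ℝ (Fin d) → 𝒴 → ℝ)
    (w : (n : ℕ) → (Fin n → 𝒳 × 𝒴) → Fin n → 𝒳 → ℝ)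
    (zn : ℕ → 𝒳 → EuclideanSpace ℝ (Fin d)) (n : ℕ) (x : 𝒳) :
    EuclideanSpace ℝ (Fin d) →L[ℝ] EuclideanSpace ℝ (Fin d) :=
  hess (weightedRisk pX κ ℓ w n x) (zn n x)

/-- The weighted score `∑ i, w_{n,i}(x) ∇ℓ(z; Y_i)`. -/
def score {𝒳 𝒴 : Type*} {d : ℕ} (ℓ : EuclideanSpace ℝ (Fin d) → 𝒴 → ℝ)
    (w : (n : ℕ) → (Fin n → 𝒳 × 𝒴) → Fin n → 𝒳 → ℝ)
    (n : ℕ) (D : Fin n → 𝒳 × 𝒴) (x : 𝒳) (z : EuclideanSpace ℝ (Fin d)) :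
    EuclideanSpace ℝ (Fin d) :=
  ∑ i, w n D i x • gradient (fun z => ℓ z (D i).2) z

/-- `z_n(x)` is a root in `Z` of `E[∑ i, w_{n,i}(x) ∇ℓ(z; Y_i)] = 0` at which the expected
weighted cost has an invertible Hessian, for large `n` and almost every `x`. -/
def IsCentre {𝒳 𝒴 : Type*} [MeasurableSpace 𝒳] [MeasurableSpace 𝒴] {d : ℕ}
    (pX : Measure 𝒳) (κ : Kernel 𝒳 𝒴) (ℓ : EuclideanSpace ℝ (Fin d) → 𝒴 → ℝ)
    (Z : Set (EuclideanSpace ℝ (Fin d)))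
    (w : (n : ℕ) → (Fin n → 𝒳 × 𝒴) → Fin n → 𝒳 → ℝ)
    (zn : ℕ → 𝒳 → EuclideanSpace ℝ (Fin d)) : Prop :=
  ∀ᶠ n : ℕ in atTop, ∀ᵐ x ∂pX,
    zn n x ∈ Z ∧
    Integrable (fun D => score ℓ w n D x (zn n x)) (dataLaw pX κ n) ∧
    ∫ D, score ℓ w n D x (zn n x) ∂(dataLaw pX κ n) = 0 ∧
    (∀ z ∈ Z, Integrable (fun D : Fin n → 𝒳 × 𝒴 => ∑ i, w n D i x * ℓ z (D i).2)
      (dataLaw pX κ n)) ∧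
    DifferentiableOn ℝ (weightedRisk pX κ ℓ w n x) Z ∧
    DifferentiableAt ℝ (gradient (weightedRisk pX κ ℓ w n x)) (zn n x) ∧
    (weightedHess pX κ ℓ w zn n x).IsInvertible

/-- The expansion
`zhat(x) - z_n(x) = -H_{n,x}⁻¹ (1/n) ∑ i, w_{n,i}(x) ∇ℓ(z_n(x); Y_i) + O(n ^ (-2 γv))`. -/
def HasScoreExpansion {𝒳 𝒴 : Type*} [MeasurableSpace 𝒳] [MeasurableSpace 𝒴] {d : ℕ}
    (pX : Measure 𝒳) (κ : Kernel 𝒳 𝒴) (ℓ : EuclideanSpace ℝ (Fin d) → 𝒴 → ℝ)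
    (w : (n : ℕ) → (Fin n → 𝒳 × 𝒴) → Fin n → 𝒳 → ℝ)
    (zhat : (n : ℕ) → (Fin n → 𝒳 × 𝒴) → 𝒳 → EuclideanSpace ℝ (Fin d))
    (zn : ℕ → 𝒳 → EuclideanSpace ℝ (Fin d)) (γv : ℝ) : Prop :=
  MeanBigO pX κ
    (fun n D x => zhat n D x - zn n x +
      (weightedHess pX κ ℓ w zn n x).inverse ((n : ℝ)⁻¹ • score ℓ w n D x (zn n x)))
    (fun n => (n : ℝ) ^ (-(2 * γv)))

open scoped Classical in
/-- The indices of the `k` nearest neighbours of `x` in the data set; ties are broken in favour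
of the smaller index. -/
def nearestIndices {𝒳 𝒴 : Type*} [MetricSpace 𝒳] {n : ℕ} (k : ℕ) (D : Fin n → 𝒳 × 𝒴) (x : 𝒳) :
    Finset (Fin n) :=
  Finset.univ.filter fun i =>
    (Finset.univ.filter fun j =>
      dist (D j).1 x < dist (D i).1 x ∨ (dist (D j).1 x = dist (D i).1 x ∧ j < i)).card < k

open scoped Classical in
/-- The nearest neighbour class: `w_{n,i}(x)` is the indicator of `X_i` being among the `k_n`
nearest neighbours of `x`, with `k_n = Θ(n ^ (2 γv))`. The Hessian `H_{k_n,x}` of the expected cost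
averaged over the `k_n` neighbours is `(n / k_n) H_{n,x}`; the influence function
`φ_{n,x}(y) = -H_{k_n,x}⁻¹ ∇ℓ(z_n(x); y)` is controlled in mean square through `H_{k_n,x}⁻¹`. -/
def NearestNeighbourClass {𝒳 𝒴 : Type*} [MetricSpace 𝒳] [MeasurableSpace 𝒳] [MeasurableSpace 𝒴]
    {d : ℕ} (pX : Measure 𝒳) (κ : Kernel 𝒳 𝒴) (ℓ : EuclideanSpace ℝ (Fin d) → 𝒴 → ℝ)
    (w : (n : ℕ) → (Fin n → 𝒳 × 𝒴) → Fin n → 𝒳 → ℝ)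
    (zn : ℕ → 𝒳 → EuclideanSpace ℝ (Fin d)) (γv : ℝ) : Prop :=
  ∃ k : ℕ → ℕ,
    (∀ n, k n ≤ n) ∧
    ((fun n => (k n : ℝ)) =Θ[atTop] fun n : ℕ => (n : ℝ) ^ (2 * γv)) ∧
    (∀ n D i x, w n D i x = if i ∈ nearestIndices (k n) D x then 1 else 0) ∧
    ∃ g : ℕ → 𝒳 → ℝ,
      (∀ n, MemLp (g n) 2 pX) ∧
      ((fun n => ∫ x, g n x ^ 2 ∂pX) =O[atTop] fun _ : ℕ => (1 : ℝ)) ∧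
      ∀ᶠ n : ℕ in atTop, ∀ᵐ x ∂pX,
        ‖(((n : ℝ) / (k n : ℝ)) • weightedHess pX κ ℓ w zn n x).inverse‖ ≤ g n x

/-- The influence function class: up to `O(n ^ (-2 γv))`, `zhat(x) - z_n(x)` is the average of
`φ_{n,x}(X_i, Y_i)` for an influence function that is centred with root mean square
`Θ(n ^ (1/2 - γv))` for almost every `x`, and that at its own data point is centred with root
mean square `O(n ^ (1 - 2 γv))`. -/
def InfluenceClass {𝒳 𝒴 : Type*} [MeasurableSpace 𝒳] [MeasurableSpace 𝒴] {d : ℕ}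
    (pX : Measure 𝒳) (κ : Kernel 𝒳 𝒴)
    (zhat : (n : ℕ) → (Fin n → 𝒳 × 𝒴) → 𝒳 → EuclideanSpace ℝ (Fin d))
    (zn : ℕ → 𝒳 → EuclideanSpace ℝ (Fin d)) (γv : ℝ) : Prop :=
  ∃ φ : ℕ → 𝒳 → 𝒳 × 𝒴 → EuclideanSpace ℝ (Fin d),
    (∀ n, Measurable fun p : 𝒳 × (𝒳 × 𝒴) => φ n p.1 p.2) ∧
    MeanBigO pX κ
      (fun n D x => zhat n D x - zn n x - (n : ℝ)⁻¹ • ∑ i, φ n x (D i))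
      (fun n => (n : ℝ) ^ (-(2 * γv))) ∧
    (∀ᶠ n : ℕ in atTop, ∀ᵐ x ∂pX, MemLp (φ n x) 2 (jointLaw pX κ) ∧
      ∫ q, φ n x q ∂(jointLaw pX κ) = 0) ∧
    (∀ᵐ x ∂pX, (fun n => √(∫ q, ‖φ n x q‖ ^ 2 ∂(jointLaw pX κ)))
      =Θ[atTop] fun n : ℕ => (n : ℝ) ^ (1 / 2 - γv)) ∧
    (∀ᶠ n : ℕ in atTop, MemLp (fun q => φ n q.1 q) 2 (jointLaw pX κ) ∧
      ∫ q, φ n q.1 q ∂(jointLaw pX κ) = 0) ∧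
    ((fun n => √(∫ q, ‖φ n q.1 q‖ ^ 2 ∂(jointLaw pX κ)))
      =O[atTop] fun n : ℕ => (n : ℝ) ^ (1 - 2 * γv))

/-- The expansion conditions on the nonparametric model. -/
def ExpansionConditions {𝒳 𝒴 : Type*} [MetricSpace 𝒳] [MeasurableSpace 𝒳] [MeasurableSpace 𝒴]
    {d : ℕ} (pX : Measure 𝒳) (κ : Kernel 𝒳 𝒴) (ℓ : EuclideanSpace ℝ (Fin d) → 𝒴 → ℝ)
    (Z : Set (EuclideanSpace ℝ (Fin d)))
    (w : (n : ℕ) → (Fin n → 𝒳 × 𝒴) → Fin n → 𝒳 → ℝ)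
    (zhat : (n : ℕ) → (Fin n → 𝒳 × 𝒴) → 𝒳 → EuclideanSpace ℝ (Fin d)) (γv : ℝ) : Prop :=
  ∃ zn : ℕ → 𝒳 → EuclideanSpace ℝ (Fin d),
    IsCentre pX κ ℓ Z w zn ∧
    HasScoreExpansion pX κ ℓ w zhat zn γv ∧
    (NearestNeighbourClass pX κ ℓ w zn γv ∨ InfluenceClass pX κ zhat zn γv)

end

end FastRate

namespace FastRate

/-! The proof resamples the `i`-th point. Fix `x = X_i`, let `D'` be the other points, and let `D^q`
be `D'` with an independent copy `q` inserted at `i`. Since `X_i` is independent of both `D'` and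
`q`, the pair `(D^q, X_i)` has the law of a data set with a fresh covariate
(`measurePreserving_insertNth`). The leave-one-out changes for `D` and `D^q` at `x` subtract the
same prediction from `D'`, so they differ by `zhat(D) - zhat(D^q)`. The expansion at size `n` alone
controls this: `z_n(x)` and the other points' influences cancel, leaving two remainders and the
effect of exchanging one point.

Averaging over `q` bounds the change at `X_i` by three kinds of term: the mean change at a fresh
covariate, at most `α_n` by Cauchy–Schwarz; remainders of mean `O(n^(-2γ))`; and the exchange
effect. In the influence case, centring removes the influence of `q`, and that of the point itself
has mean `O(n^(-1) n^(1-2γ))`. For nearest neighbours the exchange alters boundedly many score terms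
(`norm_sum_nearestIndices_sub_le`), at a cost of order `1/k_n`, that is `n^(-2γ)`. All of this is
`o(n^(-1/2))` when `γ > 1/4`. -/

theorem integral_comp_measurePreserving {α β E : Type*} [MeasurableSpace α] [MeasurableSpace β]
    [NormedAddCommGroup E] [NormedSpace ℝ E] {μ : Measure α} {ν : Measure β} {f : α → β}
    (hf : MeasurePreserving f μ ν) {g : β → E} (hg : AEStronglyMeasurable g ν) :
    ∫ a, g (f a) ∂μ = ∫ b, g b ∂ν := by
  rw [← hf.map_eq] at hg ⊢
  exact (integral_map hf.measurable.aemeasurable hg).symm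

/-- Cauchy–Schwarz, read off from nonnegativity of the variance of `‖f‖`. -/
theorem integral_norm_le_sqrt {α E : Type*} [MeasurableSpace α] [NormedAddCommGroup E]
    {μ : Measure α} [IsProbabilityMeasure μ] {f : α → E} (hf : MemLp f 2 μ) :
    ∫ a, ‖f a‖ ∂μ ≤ √(∫ a, ‖f a‖ ^ 2 ∂μ) := by
  have h := variance_nonneg (fun a => ‖f a‖) μ
  rw [variance_eq_sub hf.norm] at h
  exact Real.le_sqrt_of_sq_le (sub_nonneg.1 h)

/-! ### Independence of a covariate from the remaining and the resampled data -/

section DataLaw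

variable {𝒳 𝒴 : Type*} [MeasurableSpace 𝒳] [MeasurableSpace 𝒴]
  (pX : Measure 𝒳) [IsProbabilityMeasure pX] (κ : Kernel 𝒳 𝒴) [IsMarkovKernel κ]

instance isProbabilityMeasure_jointLaw : IsProbabilityMeasure (jointLaw pX κ) := by
  unfold jointLaw; infer_instance

instance isProbabilityMeasure_dataLaw (n : ℕ) : IsProbabilityMeasure (dataLaw pX κ n) := by
  unfold dataLaw; infer_instance

theorem measurePreserving_fst_jointLaw : MeasurePreserving Prod.fst (jointLaw pX κ) pX :=
  ⟨measurable_fst, Measure.fst_compProd pX κ⟩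

theorem measurePreserving_eval_dataLaw {n : ℕ} (i : Fin n) :
    MeasurePreserving (fun D : Fin n → 𝒳 × 𝒴 => D i) (dataLaw pX κ n) (jointLaw pX κ) :=
  measurePreserving_eval (fun _ => jointLaw pX κ) i

/-- A data point's covariate is independent of the remaining data. -/
theorem measurePreserving_removeNth_fst {m : ℕ} (i : Fin (m + 1)) :
    MeasurePreserving (fun D : Fin (m + 1) → 𝒳 × 𝒴 => (i.removeNth D, (D i).1))
      (dataLaw pX κ (m + 1)) ((dataLaw pX κ m).prod pX) :=
  (Measure.measurePreserving_swap.comp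
    ((measurePreserving_fst_jointLaw pX κ).prod (MeasurePreserving.id (dataLaw pX κ m)))).comp
    (measurePreserving_piFinSuccAbove (fun _ => jointLaw pX κ) i)

/-- Inserting an independent copy of the data point yields a data set independent of the
covariate. -/
theorem measurePreserving_insertNth {m : ℕ} (i : Fin (m + 1)) :
    MeasurePreserving
      (fun p : ((Fin m → 𝒳 × 𝒴) × 𝒳) × (𝒳 × 𝒴) =>
        ((i.insertNth p.2 p.1.1 : Fin (m + 1) → 𝒳 × 𝒴), p.1.2))
      (((dataLaw pX κ m).prod pX).prod (jointLaw pX κ)) ((dataLaw pX κ (m + 1)).prod pX) := by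
  -- `((D', x), q) ↦ (D', (x, q)) ↦ (D', (q, x)) ↦ ((D', q), x) ↦ ((q, D'), x)`, then `q` is
  -- inserted.
  have h1 := measurePreserving_prodAssoc (dataLaw pX κ m) pX (jointLaw pX κ)
  have h2 := (MeasurePreserving.id (dataLaw pX κ m)).prod
    (Measure.measurePreserving_swap (μ := pX) (ν := jointLaw pX κ))
  have h3 := (measurePreserving_prodAssoc (dataLaw pX κ m) (jointLaw pX κ) pX).symm
  have h4 := (Measure.measurePreserving_swap (μ := dataLaw pX κ m) (ν := jointLaw pX κ)).prod
    (MeasurePreserving.id pX)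
  have h5 := ((measurePreserving_piFinSuccAbove (fun _ => jointLaw pX κ) i).symm).prod
    (MeasurePreserving.id pX)
  exact h5.comp (h4.comp (h3.comp (h2.comp h1)))

variable {pX κ}

theorem ae_jointLaw_of_ae_fst {P : 𝒳 → Prop} (h : ∀ᵐ x ∂pX, P x) :
    ∀ᵐ q ∂(jointLaw pX κ), P q.1 :=
  (measurePreserving_fst_jointLaw pX κ).quasiMeasurePreserving.ae h

theorem ae_dataLaw_of_ae {P : 𝒳 × 𝒴 → Prop} (h : ∀ᵐ q ∂(jointLaw pX κ), P q) (n : ℕ) :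
    ∀ᵐ D ∂(dataLaw pX κ n), ∀ i, P (D i) :=
  ae_all_iff.2 fun i => (measurePreserving_eval_dataLaw pX κ i).quasiMeasurePreserving.ae h

end DataLaw

/-! ### Integrating the resampling inequality -/

section Stability

variable {𝒳 𝒴 : Type*} [MeasurableSpace 𝒳] [MeasurableSpace 𝒴] {d : ℕ}
  {pX : Measure 𝒳} [IsProbabilityMeasure pX] {κ : Kernel 𝒳 𝒴} [IsMarkovKernel κ]
  {zhat : (n : ℕ) → (Fin n → 𝒳 × 𝒴) → 𝒳 → EuclideanSpace ℝ (Fin d)}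

/-- The change of the prediction when the `i`-th data point is left out. -/
def looDiff (zhat : (n : ℕ) → (Fin n → 𝒳 × 𝒴) → 𝒳 → EuclideanSpace ℝ (Fin d)) {m : ℕ}
    (i : Fin (m + 1)) (D : Fin (m + 1) → 𝒳 × 𝒴) (x : 𝒳) : EuclideanSpace ℝ (Fin d) :=
  zhat (m + 1) D x - zhat m (i.removeNth D) x

theorem measurable_looDiff
    (hz : ∀ n, Measurable fun p : (Fin n → 𝒳 × 𝒴) × 𝒳 => zhat n p.1 p.2) {m : ℕ}
    (i : Fin (m + 1)) :
    Measurable fun p : (Fin (m + 1) → 𝒳 × 𝒴) × 𝒳 => looDiff zhat i p.1 p.2 := by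
  refine (hz (m + 1)).sub ((hz m).comp (f := fun p : (Fin (m + 1) → 𝒳 × 𝒴) × 𝒳 =>
    (i.removeNth p.1, p.2)) (Measurable.prodMk ?_ measurable_snd))
  exact measurable_pi_iff.2 fun j => (measurable_pi_apply (i.succAbove j)).comp measurable_fst

/-- The bound on the mean change at the data point, from a bound by the mean over an independent
copy of this data point. -/
theorem integral_looDiff_le
    (hz : ∀ n, Measurable fun p : (Fin n → 𝒳 × 𝒴) × 𝒳 => zhat n p.1 p.2)
    {C : ℝ} (hC : ∀ n D x, ‖zhat n D x‖ ≤ C) {m : ℕ} (i : Fin (m + 1))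
    {R : (Fin (m + 1) → 𝒳 × 𝒴) → 𝒳 → EuclideanSpace ℝ (Fin d)} {b : 𝒳 × 𝒴 → ℝ}
    (hR : Integrable (fun p : (Fin (m + 1) → 𝒳 × 𝒴) × 𝒳 => R p.1 p.2)
      ((dataLaw pX κ (m + 1)).prod pX))
    (hRi : Integrable (fun D => R D (D i).1) (dataLaw pX κ (m + 1)))
    (hb : Integrable b (jointLaw pX κ))
    (h : ∀ᵐ D ∂(dataLaw pX κ (m + 1)),
      Integrable (fun q => R (i.insertNth q (i.removeNth D)) (D i).1) (jointLaw pX κ) →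
      Integrable (fun q => looDiff zhat i (i.insertNth q (i.removeNth D)) (D i).1)
        (jointLaw pX κ) →
      ‖looDiff zhat i D (D i).1‖ ≤ ‖R D (D i).1‖ + b (D i) +
        ∫ q, (‖looDiff zhat i (i.insertNth q (i.removeNth D)) (D i).1‖ +
          ‖R (i.insertNth q (i.removeNth D)) (D i).1‖) ∂(jointLaw pX κ)) :
    ∫ D, ‖looDiff zhat i D (D i).1‖ ∂(dataLaw pX κ (m + 1)) ≤
      ∫ D, ‖R D (D i).1‖ ∂(dataLaw pX κ (m + 1)) + ∫ q, b q ∂(jointLaw pX κ) +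
      (√(∫ p, ‖looDiff zhat i p.1 p.2‖ ^ 2 ∂((dataLaw pX κ (m + 1)).prod pX)) +
        ∫ p, ‖R p.1 p.2‖ ∂((dataLaw pX κ (m + 1)).prod pX)) := by
  have hFm := measurable_looDiff hz i
  have hFb : ∀ D x, ‖looDiff zhat i D x‖ ≤ C + C := fun D x =>
    (norm_sub_le _ _).trans (add_le_add (hC _ _ _) (hC _ _ _))
  have hF2 : MemLp (fun p : (Fin (m + 1) → 𝒳 × 𝒴) × 𝒳 => looDiff zhat i p.1 p.2) 2
      ((dataLaw pX κ (m + 1)).prod pX) :=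
    MemLp.of_bound hFm.aestronglyMeasurable (C + C) (ae_of_all _ fun p => hFb _ _)
  have hF : Integrable (fun p : (Fin (m + 1) → 𝒳 × 𝒴) × 𝒳 => looDiff zhat i p.1 p.2)
      ((dataLaw pX κ (m + 1)).prod pX) := hF2.integrable (by norm_num)
  have hmi := measurePreserving_insertNth pX κ i
  have hmr := measurePreserving_removeNth_fst pX κ i
  have hFp := hmi.integrable_comp_of_integrable hF
  have hRp := hmi.integrable_comp_of_integrable hR
  have hsum := hFp.norm.add hRp.norm
  have hG := hsum.integral_prod_left
  have hGi := hmr.integrable_comp_of_integrable hG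
  have hbi := (measurePreserving_eval_dataLaw pX κ i).integrable_comp_of_integrable hb
  -- Fubini gives integrability in `q` for almost every `(D', x)`, hence along almost every `D`;
  -- this discharges the two premises inside `h`.
  have hae := hmr.quasiMeasurePreserving.ae (hFp.prod_right_ae.and hRp.prod_right_ae)
  have hkey : ∫ D, ‖looDiff zhat i D (D i).1‖ ∂(dataLaw pX κ (m + 1)) ≤
      ∫ D, (‖R D (D i).1‖ + b (D i) +
        ∫ q, (‖looDiff zhat i (i.insertNth q (i.removeNth D)) (D i).1‖ +
          ‖R (i.insertNth q (i.removeNth D)) (D i).1‖) ∂(jointLaw pX κ))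
        ∂(dataLaw pX κ (m + 1)) := by
    refine integral_mono_of_nonneg (ae_of_all _ fun _ => norm_nonneg _)
      ((hRi.norm.add hbi).add hGi) ?_
    filter_upwards [h, hae] with D h1 h2
    exact h1 h2.2 h2.1
  refine hkey.trans ?_
  have e1 := integral_add (hRi.norm.add hbi) hGi
  have e2 := integral_add hRi.norm hbi
  have e3 := integral_comp_measurePreserving (measurePreserving_eval_dataLaw pX κ i)
    hb.aestronglyMeasurable
  -- The average over `q` is moved from `D` to `(D', x)`, merged by Fubini, and sent by insertion to
  -- the law with a fresh covariate.
  have e4 := integral_comp_measurePreserving hmr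
    hG.aestronglyMeasurable
  have e5 := integral_prod _ hsum
  have e6 := integral_add hFp.norm hRp.norm
  have e7 := integral_comp_measurePreserving hmi
    hF.norm.aestronglyMeasurable
  have e8 := integral_comp_measurePreserving hmi
    hR.norm.aestronglyMeasurable
  have e9 : ∫ p, ‖looDiff zhat i p.1 p.2‖ ∂((dataLaw pX κ (m + 1)).prod pX) ≤
      √(∫ p, ‖looDiff zhat i p.1 p.2‖ ^ 2 ∂((dataLaw pX κ (m + 1)).prod pX)) :=
    integral_norm_le_sqrt hF2
  simp only [Function.comp_def, Pi.add_apply] at *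
  linarith

end Stability

/-! ### Rates, and the influence function case -/

section StabilityRate

variable {𝒳 𝒴 : Type*} [MeasurableSpace 𝒳] [MeasurableSpace 𝒴] {d : ℕ}
  {pX : Measure 𝒳} [IsProbabilityMeasure pX] {κ : Kernel 𝒳 𝒴} [IsMarkovKernel κ]
  {zhat : (n : ℕ) → (Fin n → 𝒳 × 𝒴) → 𝒳 → EuclideanSpace ℝ (Fin d)}

theorem isLittleO_natCast_rpow {a b : ℝ} (h : a < b) :
    (fun n : ℕ => (n : ℝ) ^ a) =o[atTop] fun n : ℕ => (n : ℝ) ^ b := by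
  refine IsLittleO.comp_tendsto (k := fun n : ℕ => (n : ℝ)) (f := fun x : ℝ => x ^ a)
    (g := fun x : ℝ => x ^ b) (l := atTop) ?_ tendsto_natCast_atTop_atTop
  refine (isLittleO_iff_tendsto' ?_).2 ((tendsto_rpow_neg_atTop (sub_pos.2 h)).congr' ?_)
  · filter_upwards [eventually_gt_atTop 0] with x hx h0
    exact absurd h0 (Real.rpow_pos_of_pos hx b).ne'
  · filter_upwards [eventually_gt_atTop 0] with x hx
    rw [neg_sub, Real.rpow_sub hx]

/-- Pointwise stability is `o(n ^ (-1/2))` if the change at a data point is dominated by a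
remainder of small mean, a term `b n` of small mean, and the mean change and remainder when the
data point is replaced by an independent copy. -/
theorem pointwiseLOO_isLittleO
    (hz : ∀ n, Measurable fun p : (Fin n → 𝒳 × 𝒴) × 𝒳 => zhat n p.1 p.2)
    {C : ℝ} (hC : ∀ n D x, ‖zhat n D x‖ ≤ C) {γ : ℝ} (hγ : 1 / 4 < γ)
    {R : (n : ℕ) → (Fin n → 𝒳 × 𝒴) → 𝒳 → EuclideanSpace ℝ (Fin d)}
    (hR : MeanBigO pX κ R fun n : ℕ => (n : ℝ) ^ (-(2 * γ)))
    {b : ℕ → 𝒳 × 𝒴 → ℝ} (hb : ∀ᶠ n in atTop, Integrable (b n) (jointLaw pX κ))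
    (hbO : (fun n => ∫ q, b n q ∂(jointLaw pX κ)) =O[atTop] fun n : ℕ => (n : ℝ) ^ (-(2 * γ)))
    (hstab : expectedLOO pX κ zhat =o[atTop] fun n : ℕ => (n : ℝ) ^ (-(1 / 2) : ℝ))
    (h : ∀ᶠ m in atTop, ∀ i : Fin (m + 1), ∀ᵐ D ∂(dataLaw pX κ (m + 1)),
      Integrable (fun q => R (m + 1) (i.insertNth q (i.removeNth D)) (D i).1) (jointLaw pX κ) →
      Integrable (fun q => looDiff zhat i (i.insertNth q (i.removeNth D)) (D i).1)
        (jointLaw pX κ) →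
      ‖looDiff zhat i D (D i).1‖ ≤ ‖R (m + 1) D (D i).1‖ + b (m + 1) (D i) +
        ∫ q, (‖looDiff zhat i (i.insertNth q (i.removeNth D)) (D i).1‖ +
          ‖R (m + 1) (i.insertNth q (i.removeNth D)) (D i).1‖) ∂(jointLaw pX κ)) :
    pointwiseLOO pX κ zhat =o[atTop] fun n : ℕ => (n : ℝ) ^ (-(1 / 2) : ℝ) := by
  obtain ⟨hR1, hR2, hR3, hR4⟩ := hR
  -- Here `γ > 1/4` enters.
  have hsmall : (fun n : ℕ => (n : ℝ) ^ (-(2 * γ))) =o[atTop]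
      fun n : ℕ => (n : ℝ) ^ (-(1 / 2) : ℝ) := isLittleO_natCast_rpow (by linarith)
  have htot := ((hR4.trans_isLittleO hsmall).add (hbO.trans_isLittleO hsmall)).add
    (hstab.add (hR2.trans_isLittleO hsmall))
  refine IsBigO.trans_isLittleO (IsBigO.of_bound 1 ?_) htot
  have hshift := tendsto_add_atTop_nat 1
  rw [← map_add_atTop_eq_nat 1, eventually_map]
  filter_upwards [h, hshift.eventually hb, hshift.eventually hR1, hshift.eventually hR3]
    with m hm hbm hR1m hR3m
  have hpos : 0 ≤ pointwiseLOO pX κ zhat (m + 1) :=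
    Real.iSup_nonneg fun i => integral_nonneg fun D => norm_nonneg _
  rw [one_mul, Real.norm_of_nonneg hpos]
  refine le_trans ?_ (le_abs_self _)
  refine ciSup_le fun i => ?_
  refine (integral_looDiff_le hz hC i hR1m (hR3m i) hbm (hm i)).trans ?_
  refine add_le_add (add_le_add ?_ le_rfl) (add_le_add ?_ le_rfl)
  · exact le_ciSup (f := fun i : Fin (m + 1) =>
      ∫ D, ‖R (m + 1) D (D i).1‖ ∂(dataLaw pX κ (m + 1))) (Set.finite_range _).bddAbove i
  · exact le_ciSup (f := fun i : Fin (m + 1) =>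
      √(∫ p, ‖zhat (m + 1) p.1 p.2 - zhat m (i.removeNth p.1) p.2‖ ^ 2
        ∂((dataLaw pX κ (m + 1)).prod pX))) (Set.finite_range _).bddAbove i

/-- An influence function expansion makes a learner with fast expected stability
pointwise stable. -/
theorem pointwiseLOO_isLittleO_of_influenceClass
    (hz : ∀ n, Measurable fun p : (Fin n → 𝒳 × 𝒴) × 𝒳 => zhat n p.1 p.2)
    {C : ℝ} (hC : ∀ n D x, ‖zhat n D x‖ ≤ C) {γ : ℝ} (hγ : 1 / 4 < γ)
    {zn : ℕ → 𝒳 → EuclideanSpace ℝ (Fin d)} (hφ : InfluenceClass pX κ zhat zn γ)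
    (hstab : expectedLOO pX κ zhat =o[atTop] fun n : ℕ => (n : ℝ) ^ (-(1 / 2) : ℝ)) :
    pointwiseLOO pX κ zhat =o[atTop] fun n : ℕ => (n : ℝ) ^ (-(1 / 2) : ℝ) := by
  obtain ⟨φ, -, hR, hcen, -, hdiag, hdiagO⟩ := hφ
  refine pointwiseLOO_isLittleO hz hC hγ hR (b := fun n q => (n : ℝ)⁻¹ * ‖φ n q.1 q‖)
    ?_ ?_ hstab ?_
  · filter_upwards [hdiag] with n hn
    exact (hn.1.integrable (by norm_num)).norm.const_mul _
  · have h1 : (fun n : ℕ => (n : ℝ)⁻¹ * √(∫ q, ‖φ n q.1 q‖ ^ 2 ∂(jointLaw pX κ))) =O[atTop]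
        fun n : ℕ => (n : ℝ)⁻¹ * (n : ℝ) ^ (1 - 2 * γ) := (isBigO_refl _ _).mul hdiagO
    have h2 : (fun n : ℕ => (n : ℝ)⁻¹ * (n : ℝ) ^ (1 - 2 * γ)) =ᶠ[atTop]
        fun n : ℕ => (n : ℝ) ^ (-(2 * γ)) := by
      filter_upwards [eventually_gt_atTop 0] with n hn
      have hn' : (0 : ℝ) < n := by exact_mod_cast hn
      rw [← Real.rpow_neg_one, ← Real.rpow_add hn']
      ring_nf
    refine IsBigO.trans (IsBigO.of_bound 1 ?_) (h1.trans_eventuallyEq h2)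
    filter_upwards [hdiag] with n hn
    rw [one_mul, integral_const_mul, norm_mul, norm_mul]
    refine mul_le_mul_of_nonneg_left ?_ (norm_nonneg _)
    rw [Real.norm_of_nonneg (integral_nonneg fun q => norm_nonneg _)]
    exact (integral_norm_le_sqrt hn.1).trans (le_abs_self _)
  · filter_upwards [(tendsto_add_atTop_nat 1).eventually hcen] with m hm i
    have hx := (measurePreserving_eval_dataLaw pX κ i).quasiMeasurePreserving.ae
      (ae_jointLaw_of_ae_fst (κ := κ) hm)
    filter_upwards [hx] with D hD hRint hFint
    set x := (D i).1 with hxdef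
    set D' := i.removeNth D with hD'
    set R : (Fin (m + 1) → 𝒳 × 𝒴) → 𝒳 → EuclideanSpace ℝ (Fin d) := fun D x =>
      zhat (m + 1) D x - zn (m + 1) x - ((m + 1 : ℕ) : ℝ)⁻¹ • ∑ i, φ (m + 1) x (D i) with hRdef
    -- The part of change minus remainder that does not involve the inserted point. By centring it
    -- is the average over `q`, so it inherits the stability at a fresh covariate.
    set c : EuclideanSpace ℝ (Fin d) := zn (m + 1) x - zhat m D' x +
      ((m + 1 : ℕ) : ℝ)⁻¹ • ∑ j, φ (m + 1) x (D' j) with hc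
    have key : ∀ q, looDiff zhat i (i.insertNth q D') x - R (i.insertNth q D') x =
        c + ((m + 1 : ℕ) : ℝ)⁻¹ • φ (m + 1) x q := by
      intro q
      simp only [looDiff, hRdef, hc, Fin.removeNth_insertNth, Fin.sum_univ_succAbove _ i,
        Fin.insertNth_apply_same, Fin.insertNth_apply_succAbove, smul_add]
      abel
    have hφi : Integrable (φ (m + 1) x) (jointLaw pX κ) := hD.1.integrable (by norm_num)
    have hint : ∫ q, (looDiff zhat i (i.insertNth q D') x - R (i.insertNth q D') x)
        ∂(jointLaw pX κ) = c := by
      simp_rw [key]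
      rw [integral_add (f := fun _ => c) (g := fun q => ((m + 1 : ℕ) : ℝ)⁻¹ • φ (m + 1) x q)
        (integrable_const _) (hφi.smul (((m + 1 : ℕ) : ℝ)⁻¹)), integral_smul, hD.2]
      simp
    have hself : looDiff zhat i D x = R D x + ((m + 1 : ℕ) : ℝ)⁻¹ • φ (m + 1) x (D i) + c := by
      -- Inserting the original point recovers `D`.
      have := key (D i)
      rw [hD', Fin.insertNth_self_removeNth] at this
      rw [add_assoc, add_comm _ c, ← this]
      abel
    have hcle : ‖c‖ ≤ ∫ q, (‖looDiff zhat i (i.insertNth q D') x‖ +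
        ‖R (i.insertNth q D') x‖) ∂(jointLaw pX κ) := by
      rw [← hint]
      refine (norm_integral_le_integral_norm _).trans ?_
      exact integral_mono (hFint.sub hRint).norm (hFint.norm.add hRint.norm)
        fun q => norm_sub_le _ _
    have hb : ‖((m + 1 : ℕ) : ℝ)⁻¹ • φ (m + 1) x (D i)‖ =
        ((m + 1 : ℕ) : ℝ)⁻¹ * ‖φ (m + 1) x (D i)‖ := by
      rw [norm_smul, Real.norm_of_nonneg (by positivity)]
    rw [hself]
    exact (norm_add_le _ _).trans (add_le_add ((norm_add_le _ _).trans
      (add_le_add le_rfl hb.le)) hcle)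

end StabilityRate

/-! ### Ranks by distance, and the nearest neighbour case -/

section NearestNeighbours

variable {𝒳 𝒴 : Type*} [MetricSpace 𝒳]

/-- The `j`-th data point precedes the `i`-th one in the order of distance to `x`. -/
def Precedes {n : ℕ} (D : Fin n → 𝒳 × 𝒴) (x : 𝒳) (j i : Fin n) : Prop :=
  dist (D j).1 x < dist (D i).1 x ∨ (dist (D j).1 x = dist (D i).1 x ∧ j < i)

open scoped Classical in
/-- The number of data points that precede the `i`-th one in the order of distance to `x`. -/
noncomputable def distRank {n : ℕ} (D : Fin n → 𝒳 × 𝒴) (x : 𝒳) (i : Fin n) : ℕ :=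
  (Finset.univ.filter fun j => Precedes D x j i).card

open scoped Classical in
theorem mem_nearestIndices {n k : ℕ} {D : Fin n → 𝒳 × 𝒴} {x : 𝒳} {i : Fin n} :
    i ∈ nearestIndices k D x ↔ distRank D x i < k := by
  simp only [nearestIndices, distRank, Finset.mem_filter, Finset.mem_univ, true_and]
  -- The two filters agree up to unfolding `Precedes` and the choice of decidability instance.
  refine iff_of_eq (congrArg (fun s : Finset (Fin n) => s.card < k) (Finset.ext fun j => ?_))
  rw [Finset.mem_filter, Finset.mem_filter]
  rfl

theorem Precedes.trans {n : ℕ} {D : Fin n → 𝒳 × 𝒴} {x : 𝒳} {i j l : Fin n}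
    (h : Precedes D x i j) (h' : Precedes D x j l) : Precedes D x i l := by
  unfold Precedes at *
  grind

theorem Precedes.irrefl {n : ℕ} (D : Fin n → 𝒳 × 𝒴) (x : 𝒳) (i : Fin n) :
    ¬ Precedes D x i i := by
  simp [Precedes]

theorem Precedes.total {n : ℕ} (D : Fin n → 𝒳 × 𝒴) (x : 𝒳) {i j : Fin n} (h : i ≠ j) :
    Precedes D x i j ∨ Precedes D x j i := by
  unfold Precedes
  grind

theorem Precedes.distRank_lt {n : ℕ} {D : Fin n → 𝒳 × 𝒴} {x : 𝒳} {i j : Fin n}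
    (h : Precedes D x i j) : distRank D x i < distRank D x j := by
  classical
  refine Finset.card_lt_card (Finset.ssubset_iff_of_subset ?_ |>.2 ⟨i, ?_, ?_⟩)
  · intro l hl
    simp only [Finset.mem_filter, Finset.mem_univ, true_and] at hl ⊢
    exact hl.trans h
  · simpa using h
  · simpa using Precedes.irrefl D x i

theorem distRank_injective {n : ℕ} (D : Fin n → 𝒳 × 𝒴) (x : 𝒳) :
    Function.Injective (distRank D x) := by
  intro i j hij
  by_contra hne
  rcases Precedes.total D x hne with h | h <;> have := h.distRank_lt <;> omega

-- Deleting point `i` lowers by one the rank of exactly the points it preceded. Tie-breaking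
-- survives because `succAbove` is strictly increasing.
open scoped Classical in
theorem distRank_succAbove {m : ℕ} (D : Fin (m + 1) → 𝒳 × 𝒴) (x : 𝒳) (i : Fin (m + 1))
    (j : Fin m) :
    distRank D x (i.succAbove j) =
      (if Precedes D x i (i.succAbove j) then 1 else 0) + distRank (i.removeNth D) x j := by
  simp only [distRank, Finset.card_filter]
  rw [Fin.sum_univ_succAbove _ i]
  congr 1
  refine Finset.sum_congr rfl fun l _ => if_congr ?_ rfl rfl
  simp [Precedes, Fin.removeNth]

/-- Leaving out one data point changes a bounded sum over the nearest neighbours by at most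
two terms. -/
theorem norm_sum_nearestIndices_sub_le {E : Type*} [NormedAddCommGroup E] {m k : ℕ}
    (D : Fin (m + 1) → 𝒳 × 𝒴) (x : 𝒳) (i : Fin (m + 1)) {a : Fin (m + 1) → E} {M : ℝ}
    (ha : ∀ j, ‖a j‖ ≤ M) :
    ‖∑ j ∈ nearestIndices k D x, a j -
      ∑ j ∈ nearestIndices k (i.removeNth D) x, a (i.succAbove j)‖ ≤ 2 * M := by
  classical
  set D' := i.removeNth D
  have hM : 0 ≤ M := (norm_nonneg _).trans (ha i)
  set B := Finset.univ.filter fun j : Fin m =>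
    j ∈ nearestIndices k D' x ∧ i.succAbove j ∉ nearestIndices k D x with hB
  have hrank : ∀ j, distRank D x (i.succAbove j) =
      (if Precedes D x i (i.succAbove j) then 1 else 0) + distRank D' x j :=
    distRank_succAbove D x i
  -- An index entering after the deletion has new rank below `k` and old rank at least `k`; ranks
  -- drop by at most one, so its new rank is `k - 1`, which only one index can have.
  have hBcard : B.card ≤ 1 := by
    refine Finset.card_le_one.2 fun j hj l hl => distRank_injective D' x ?_
    simp only [hB, Finset.mem_filter, Finset.mem_univ, true_and, mem_nearestIndices, hrank,
      not_lt] at hj hl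
    split_ifs at hj hl <;> omega
  have hsplit : ∑ j ∈ nearestIndices k D x, a j -
      ∑ j ∈ nearestIndices k D' x, a (i.succAbove j) =
      (if i ∈ nearestIndices k D x then a i else 0) - ∑ j ∈ B, a (i.succAbove j) := by
    have e : ∀ {n : ℕ} (s : Finset (Fin n)) (f : Fin n → E),
        ∑ j ∈ s, f j = ∑ j, if j ∈ s then f j else 0 := fun s f => by simp
    rw [e, e (nearestIndices k D' x), e B, Fin.sum_univ_succAbove _ i, add_sub_assoc,
      sub_eq_add_neg (ite _ _ _), ← Finset.sum_sub_distrib, ← Finset.sum_neg_distrib]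
    congr 1
    refine Finset.sum_congr rfl fun j _ => ?_
    -- Deletion never raises a rank, so no surviving neighbour is lost.
    have hsub : i.succAbove j ∈ nearestIndices k D x → j ∈ nearestIndices k D' x := by
      simp only [mem_nearestIndices, hrank]
      intro h
      omega
    by_cases h1 : j ∈ nearestIndices k D' x <;>
      by_cases h2 : i.succAbove j ∈ nearestIndices k D x <;> simp_all
  rw [hsplit, two_mul]
  refine (norm_sub_le _ _).trans (add_le_add ?_ ?_)
  · split_ifs
    · exact ha i
    · simpa using hM
  · refine (norm_sum_le_of_le B fun j _ => ha _).trans ?_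
    rw [Finset.sum_const, nsmul_eq_mul]
    exact mul_le_of_le_one_left hM (by exact_mod_cast hBcard)

theorem inverse_smul_of_isInvertible {E : Type*} [NormedAddCommGroup E] [NormedSpace ℝ E]
    {H : E →L[ℝ] E} (hH : H.IsInvertible) {c : ℝ} (hc : c ≠ 0) :
    (c • H).inverse = c⁻¹ • H.inverse := by
  refine ContinuousLinearMap.inverse_eq ?_ ?_
  · ext v
    simp [hc, hH.self_apply_inverse]
  · ext v
    simp [hc, hH.inverse_apply_self]

variable [MeasurableSpace 𝒳] [MeasurableSpace 𝒴] {d : ℕ}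
  {pX : Measure 𝒳} [IsProbabilityMeasure pX] {κ : Kernel 𝒳 𝒴} [IsMarkovKernel κ]
  {ℓ : EuclideanSpace ℝ (Fin d) → 𝒴 → ℝ} {Z : Set (EuclideanSpace ℝ (Fin d))}
  {w : (n : ℕ) → (Fin n → 𝒳 × 𝒴) → Fin n → 𝒳 → ℝ}
  {zhat : (n : ℕ) → (Fin n → 𝒳 × 𝒴) → 𝒳 → EuclideanSpace ℝ (Fin d)}

/-- A nearest neighbour learner with fast expected stability is pointwise stable. -/
theorem pointwiseLOO_isLittleO_of_nearestNeighbourClass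
    (hz : ∀ n, Measurable fun p : (Fin n → 𝒳 × 𝒴) × 𝒳 => zhat n p.1 p.2)
    {C : ℝ} (hC : ∀ n D x, ‖zhat n D x‖ ≤ C) {γ : ℝ} (hγ : 1 / 4 < γ)
    (hreg : RegularCost pX κ ℓ Z)
    {zn : ℕ → 𝒳 → EuclideanSpace ℝ (Fin d)} (hzn : IsCentre pX κ ℓ Z w zn)
    (hR : HasScoreExpansion pX κ ℓ w zhat zn γ) (hNN : NearestNeighbourClass pX κ ℓ w zn γ)
    (hstab : expectedLOO pX κ zhat =o[atTop] fun n : ℕ => (n : ℝ) ^ (-(1 / 2) : ℝ)) :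
    pointwiseLOO pX κ zhat =o[atTop] fun n : ℕ => (n : ℝ) ^ (-(1 / 2) : ℝ) := by
  obtain ⟨k, -, hk, hw, g, hg2, hgO, hgH⟩ := hNN
  obtain ⟨-, M₀, hM₀⟩ := hreg
  set M := |M₀|
  have hM' : ∀ᵐ q ∂(jointLaw pX κ), ∀ z ∈ Z,
      |ℓ z q.2| ≤ M ∧ ‖gradient (fun z => ℓ z q.2) z‖ ≤ M :=
    (ae_of_ae_map measurable_snd.aemeasurable hM₀).mono fun q hq z hz =>
      ⟨(hq z hz).1.trans (le_abs_self _), (hq z hz).2.trans (le_abs_self _)⟩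
  have hMpos : 0 ≤ M := abs_nonneg _
  have hkpos : ∀ᶠ n in atTop, 0 < k n := by
    have := hk.isBigO_symm.eq_zero_imp
    filter_upwards [this, eventually_gt_atTop 0] with n hn hn0
    by_contra h0
    have h1 := hn (by simpa using h0)
    have h2 : (0 : ℝ) < (n : ℝ) ^ (2 * γ) := Real.rpow_pos_of_pos (by exact_mod_cast hn0) _
    exact h2.ne' h1
  have hgi : ∀ n, Integrable (g n) pX := fun n => (hg2 n).integrable (by norm_num)
  -- The scores of `D` and `D^q` each lie within `2M` of a common one, hence `4M`; the factor `g /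
  -- k` bounds `n⁻¹ H_{n,x}⁻¹ = k⁻¹ H_{k,x}⁻¹`.
  refine pointwiseLOO_isLittleO hz hC hγ hR (b := fun n q => (k n : ℝ)⁻¹ * (4 * M) * g n q.1)
    ?_ ?_ hstab ?_
  · exact Eventually.of_forall fun n => ((measurePreserving_fst_jointLaw pX
      κ).integrable_comp_of_integrable (hgi n)).const_mul _
  · have h1 : (fun n => ∫ x, g n x ∂pX) =O[atTop] fun _ : ℕ => (1 : ℝ) := by
      obtain ⟨c, hc⟩ := hgO.bound
      refine IsBigO.of_bound (√c) ?_
      filter_upwards [hc] with n hn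
      rw [norm_one, mul_one] at hn ⊢
      refine (norm_integral_le_integral_norm _).trans ((integral_norm_le_sqrt (hg2 n)).trans ?_)
      refine Real.sqrt_le_sqrt ((le_abs_self _).trans ?_)
      simpa using hn
    have h2 : (fun n => (k n : ℝ)⁻¹) =O[atTop] fun n : ℕ => (n : ℝ) ^ (-(2 * γ)) := by
      refine hk.inv.isBigO.congr_right fun n => ?_
      rw [Real.rpow_neg n.cast_nonneg]
    have h3 := (h2.mul (isBigO_refl (fun _ : ℕ => 4 * M) atTop)).mul h1
    have h4 : (fun n : ℕ => (n : ℝ) ^ (-(2 * γ)) * (4 * M) * 1) =O[atTop]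
        fun n : ℕ => (n : ℝ) ^ (-(2 * γ)) := by
      simpa [mul_comm] using (isBigO_refl (fun n : ℕ => (n : ℝ) ^ (-(2 * γ))) atTop).const_mul_left
        (4 * M)
    refine IsBigO.congr_left (h3.trans h4) fun n => ?_
    rw [integral_const_mul]
    congr 1
    exact (integral_comp_measurePreserving (measurePreserving_fst_jointLaw pX κ)
      (hgi n).aestronglyMeasurable).symm
  · have hshift := tendsto_add_atTop_nat 1
    filter_upwards [hshift.eventually hkpos, hshift.eventually hzn, hshift.eventually hgH]
      with m hkm hznm hgm i
    have hx := (measurePreserving_eval_dataLaw pX κ i).quasiMeasurePreserving.ae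
      (ae_jointLaw_of_ae_fst (κ := κ) (hznm.and hgm))
    filter_upwards [hx, ae_dataLaw_of_ae hM' (m + 1)] with D hD hDM hRint hFint
    obtain ⟨⟨hzZ, -, -, -, -, -, hinv⟩, hgx⟩ := hD
    set x := (D i).1 with hxdef
    set D' := i.removeNth D with hD'
    set z := zn (m + 1) x with hzdef
    set H := weightedHess pX κ ℓ w zn (m + 1) x with hH
    set R : (Fin (m + 1) → 𝒳 × 𝒴) → EuclideanSpace ℝ (Fin d) := fun D =>
      zhat (m + 1) D x - z + H.inverse (((m + 1 : ℕ) : ℝ)⁻¹ • score ℓ w (m + 1) D x z) with hRdef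
    -- The common reference score takes `k (m + 1)` neighbours, not `k m`, among the `m` remaining
    -- points, so that only the deletion matters.
    set S : EuclideanSpace ℝ (Fin d) := ∑ j ∈ nearestIndices (k (m + 1)) D' x,
      gradient (fun z => ℓ z (D' j).2) z with hS
    have hscore : ∀ D₁ : Fin (m + 1) → 𝒳 × 𝒴, i.removeNth D₁ = D' →
        (∀ j, ‖gradient (fun z => ℓ z (D₁ j).2) z‖ ≤ M) →
        ‖score ℓ w (m + 1) D₁ x z - S‖ ≤ 2 * M := by
      intro D₁ h1 h2
      have h3 := norm_sum_nearestIndices_sub_le (k := k (m + 1)) D₁ x i h2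
      have h4 : score ℓ w (m + 1) D₁ x z = ∑ j ∈ nearestIndices (k (m + 1)) D₁ x,
          gradient (fun z => ℓ z (D₁ j).2) z := by
        simp [score, hw, ite_smul]
      rw [h4, hS, ← h1]
      exact h3
    have hDS := hscore D rfl fun j => (hDM j z hzZ).2
    have hk0 : (0 : ℝ) < k (m + 1) := by exact_mod_cast hkm
    have hinvle : ∀ v, ‖H.inverse (((m + 1 : ℕ) : ℝ)⁻¹ • v)‖ ≤
        (k (m + 1) : ℝ)⁻¹ * g (m + 1) x * ‖v‖ := by
      intro v
      have hn0 : (0 : ℝ) < (m + 1 : ℕ) := by positivity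
      have h1 := inverse_smul_of_isInvertible hinv (div_pos hn0 hk0).ne'
      have h2 : H.inverse (((m + 1 : ℕ) : ℝ)⁻¹ • v) =
          (k (m + 1) : ℝ)⁻¹ • ((((m + 1 : ℕ) : ℝ) / (k (m + 1) : ℝ)) • H).inverse v := by
        rw [h1, map_smul, smul_apply, smul_smul]
        congr 1
        field_simp
      rw [h2, norm_smul, Real.norm_of_nonneg (by positivity), mul_assoc]
      exact mul_le_mul_of_nonneg_left (ContinuousLinearMap.le_of_opNorm_le _ hgx v) (by positivity)
    have hpt : ∀ᵐ q ∂(jointLaw pX κ), ‖looDiff zhat i D x‖ - (‖R D‖ +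
        (k (m + 1) : ℝ)⁻¹ * (4 * M) * g (m + 1) x) ≤
        ‖looDiff zhat i (i.insertNth q D') x‖ + ‖R (i.insertNth q D')‖ := by
      filter_upwards [hM'] with q hq
      have hqS := hscore (i.insertNth q D') (by simp) (i.forall_iff_succAbove.2
        ⟨by simpa using (hq z hzZ).2, fun j => by
          simpa using! (hDM (i.succAbove j) z hzZ).2⟩)
      set s := score ℓ w (m + 1) D x z
      set s' := score ℓ w (m + 1) (i.insertNth q D') x z
      have hss : ‖s' - s‖ ≤ 4 * M := by
        have : s' - s = (s' - S) - (s - S) := by abel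
        rw [this]
        exact (norm_sub_le _ _).trans (by linarith)
      -- Both `z` and the prediction from `D'` cancel.
      have hid : looDiff zhat i D x = R D + H.inverse (((m + 1 : ℕ) : ℝ)⁻¹ • (s' - s)) +
          (looDiff zhat i (i.insertNth q D') x - R (i.insertNth q D')) := by
        simp only [looDiff, hRdef, Fin.removeNth_insertNth, smul_sub, map_sub]
        abel
      have hg0 : 0 ≤ g (m + 1) x := (norm_nonneg _).trans hgx
      have h1 : ‖H.inverse (((m + 1 : ℕ) : ℝ)⁻¹ • (s' - s))‖ ≤
          (k (m + 1) : ℝ)⁻¹ * (4 * M) * g (m + 1) x := by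
        refine (hinvle _).trans ?_
        rw [mul_right_comm]
        gcongr
      have h2 := norm_add_le (R D + H.inverse (((m + 1 : ℕ) : ℝ)⁻¹ • (s' - s)))
        (looDiff zhat i (i.insertNth q D') x - R (i.insertNth q D'))
      have h3 := norm_add_le (R D) (H.inverse (((m + 1 : ℕ) : ℝ)⁻¹ • (s' - s)))
      have h4 := norm_sub_le (looDiff zhat i (i.insertNth q D') x) (R (i.insertNth q D'))
      rw [← hid] at h2
      linarith
    -- The left side is constant in `q`, so averaging leaves it unchanged.
    have hfin := integral_mono_ae (integrable_const _) (hFint.norm.add hRint.norm) hpt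
    rw [integral_const, probReal_univ, one_smul] at hfin
    have := sub_le_iff_le_add'.1 hfin
    exact this

end NearestNeighbours

end FastRate

theorem mainTheorem7 {𝒳 𝒴 : Type*} [MetricSpace 𝒳] [SecondCountableTopology 𝒳]
    [MeasurableSpace 𝒳] [BorelSpace 𝒳] [MeasurableSpace 𝒴] {d : ℕ}
    (pX : Measure 𝒳) [IsProbabilityMeasure pX] (κ : Kernel 𝒳 𝒴) [IsMarkovKernel κ]
    (ℓ : EuclideanSpace ℝ (Fin d) → 𝒴 → ℝ) (Z : Set (EuclideanSpace ℝ (Fin d)))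
    (w : (n : ℕ) → (Fin n → 𝒳 × 𝒴) → Fin n → 𝒳 → ℝ)
    (zhat : (n : ℕ) → (Fin n → 𝒳 × 𝒴) → 𝒳 → EuclideanSpace ℝ (Fin d)) (γv : ℝ)
    (hmeas : Measurable fun p : EuclideanSpace ℝ (Fin d) × 𝒴 => ℓ p.1 p.2)
    (hcost : FastRate.SmoothExpectedCost κ ℓ Z)
    (hreg : FastRate.RegularCost pX κ ℓ Z)
    (hopt : FastRate.OptimalityConditions κ ℓ Z)
    (hlearner : FastRate.IsWeightedLearner pX κ ℓ Z w zhat)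
    (hrate : FastRate.HasVariabilityRate pX κ zhat γv)
    (hexp : FastRate.ExpansionConditions pX κ ℓ Z w zhat γv)
    (hstab : FastRate.expectedLOO pX κ zhat =o[atTop] fun n : ℕ => (n : ℝ) ^ (-(1 / 2) : ℝ))
    (hγ : 1 / 4 < γv) :
    FastRate.pointwiseLOO pX κ zhat =o[atTop] fun n : ℕ => (n : ℝ) ^ (-(1 / 2) : ℝ) := by
  -- Boundedness of `Z` bounds all predictions uniformly, which makes their differences square
  -- integrable.
  obtain ⟨C, hC⟩ := hopt.2.1.exists_norm_le
  have hz : ∀ n D x, ‖zhat n D x‖ ≤ C := fun n D x => hC _ (hlearner.mem n D x)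
  obtain ⟨zn, hzn, hR, hNN | hφ⟩ := hexp
  · exact FastRate.pointwiseLOO_isLittleO_of_nearestNeighbourClass hlearner.measurable_zhat hz hγ
      hreg hzn hR hNN hstab
  · exact FastRate.pointwiseLOO_isLittleO_of_influenceClass hlearner.measurable_zhat hz hγ hφ hstab
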